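/- Let $(W,S)$ be a Coxeter system with $S$ finite, $|S|=n$, and with orders $m_{st}\in\{1,2,\dots\}\cup\{\infty\}$. Let $B=(B_{st})_{s,t\in S}$ be a symmetric real matrix with $B_{st}=-\cos(\pi/m_{st})$ if $m_{st}<\infty$ and $B_{st}\le -1$ if $m_{st}=\infty$. Let $V$ be the real vector space with basis $\Delta=\{\alpha_s\}_{s\in S}$ (the simple roots), with the bilinear form $\mathcal B$ given by $\mathcal B(\alpha_s,\alpha_t)=B_{st}$, and let $W$ act on $V$ by letting $s\in S$ act as the reflection $x\mapsto x-2\frac{\mathcal B(x,\alpha_s)}{\mathcal B(\alpha_s,\alpha_s)}\alpha_s$. Assume that the system is Lorentzian, i.e. that $\mathcal B$ has signature $(n-1,1)$. Let $\Phi=W(\Delta)$ be the set of roots and $\Phi^+$ the set of roots that are non-negative combinations of $\Delta$. For $0\ne x\in V$ let $\widehat x$ be the line $\mathbb{R}x$, a point of the projective space $\mathbb{P}V$ with its usual topology, on which $W$ acts by $w\cdot\widehat x=\widehat{w(x)}$; for $X\subseteq V$ put $\widehat X=\{\widehat x : 0\neq x\in X\}$. The limit roots are the accumulation points of $\widehat\Phi$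 in $\mathbb{P}V$. A point $q\in\mathbb{P}V$ is said to arise from a base point $p\in\mathbb{P}V$ through a sequence $(g_k)$ in $W$ if the points $g_k\cdot p$ are pairwise distinct and converge to $q$. Let $\mathbf w=s_1s_2s_3\cdots$ be an infinite reduced word, i.e. a sequence in $S$ such that each prefix $w_k=s_1\cdots s_k$ ($k\ge 0$) is a reduced expression, and let $\operatorname{inv}(\mathbf w)$ be its inversion set, the set of positive roots of the form $w_{k-1}(\alpha_{s_k})$, $k\ge 1$. Then $\widehat{\operatorname{inv}(\mathbf w)}$ has exactly one accumulation point $\widehat\gamma(\mathbf w)$ in $\mathbb{P}V$, and $\widehat\gamma(\mathbf w)$ is a limit root. Moreover, $\widehat\gamma(\mathbf w)$ arises through the sequence of prefixes $(w_k)_{k\ge 0}$, i.e. it arises from some base point $p\in\mathbb{P}V$ through $(w_k)_{k\ge0}$; and for every projective root $p\in\widehat\Phi$ and every subsequence $(w_{k_j})_j$ of the prefixes for which the points $w_{k_j}\cdot p$ are pairwise distinct, $\widehat\gamma(\mathbf w)$ arises from $p$ through $(w_{k_j})_j$. -/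

import Mathlib

open scoped LinearAlgebra.Projectivization

namespace GeomCox

noncomputable section

/-- The real projective space `ℙ V` of lines in `V` carries the quotient topology of `V \ {0}`. -/
instance projTopology {S : Type*} : TopologicalSpace (ℙ ℝ (S → ℝ)) :=
  TopologicalSpace.coinduced (Projectivization.mk' ℝ) inferInstance

/-- The set of directions (lines) of the non-zero vectors of `X`. -/
def proj {S : Type*} (X : Set (S → ℝ)) : Set (ℙ ℝ (S → ℝ)) :=
  {p | ∃ x ∈ X, ∃ hx : x ≠ 0, p = Projectivization.mk ℝ x hx}

/-- `x` arises from the base point `x₀` through the sequence `g`: the points `g k • x₀` are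
pairwise distinct and converge to `x`. -/
def ArisesFromThrough {G X : Type*} [TopologicalSpace X] [SMul G X]
    (x x₀ : X) (g : ℕ → G) : Prop :=
  Function.Injective (fun k => g k • x₀) ∧
    Filter.Tendsto (fun k => g k • x₀) Filter.atTop (nhds x)

/-- `B` is a matrix associated with the Coxeter matrix `M`
(in which the entry `0` encodes `m_{st} = ∞`). -/
structure IsGeometric {S : Type*} (M : CoxeterMatrix S) (B : Matrix S S ℝ) : Prop where
  symm : ∀ s t, B s t = B t s
  finite : ∀ s t, M s t ≠ 0 → B s t = -Real.cos (Real.pi / (M s t : ℝ))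
  infinite : ∀ s t, M s t = 0 → B s t ≤ -1

lemma IsGeometric.diag {S : Type*} {M : CoxeterMatrix S} {B : Matrix S S ℝ}
    (hB : IsGeometric M B) (s : S) : B s s = 1 := by
  rw [hB.finite s s (by simp)]
  simp

variable {S : Type*} [Fintype S] [DecidableEq S]

/-- The bilinear form of `B` on `V = ℝ^S`. -/
def form (B : Matrix S S ℝ) : LinearMap.BilinForm ℝ (S → ℝ) := Matrix.toBilin' B

/-- The form of `B` has signature `(n - 1, 1)`, where `n = |S|`. -/
def IsLorentzian (B : Matrix S S ℝ) : Prop :=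
  sigPos (form B).toQuadraticMap + 1 = Fintype.card S ∧ sigNeg (form B).toQuadraticMap = 1

/-- The simple root `α_s`. -/
def simpleRoot (s : S) : S → ℝ := Pi.single s 1

/-- The linear functional `x ↦ 2 B(x, α) / B(α, α)`. -/
def coroot (B : Matrix S S ℝ) (α : S → ℝ) : Module.Dual ℝ (S → ℝ) :=
  (2 / form B α α) • (form B).flip α

lemma form_simpleRoot (B : Matrix S S ℝ) (s t : S) :
    form B (simpleRoot s) (simpleRoot t) = B s t := by
  simp [form, simpleRoot]

section Geometric

variable {M : CoxeterMatrix S} {B : Matrix S S ℝ}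

lemma IsGeometric.coroot_simpleRoot (hB : IsGeometric M B) (s t : S) :
    coroot B (simpleRoot s) (simpleRoot t) = 2 * B t s := by
  simp [coroot, form_simpleRoot, hB.diag]

/-- The reflection `x ↦ x - 2 B(x, α_s) / B(α_s, α_s) α_s`. -/
def simpleReflection (hB : IsGeometric M B) (s : S) : (S → ℝ) ≃ₗ[ℝ] (S → ℝ) :=
  Module.reflection (x := simpleRoot s) (f := coroot B (simpleRoot s))
    (by rw [hB.coroot_simpleRoot, hB.diag, mul_one])

lemma simpleReflection_apply (hB : IsGeometric M B) (s : S) (x : S → ℝ) :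
    simpleReflection hB s x =
      x - (2 * form B x (simpleRoot s) / form B (simpleRoot s) (simpleRoot s)) • simpleRoot s := by
  rw [simpleReflection, Module.reflection_apply]
  simp [coroot, form_simpleRoot, hB.diag]

/-- The reflections in the simple roots satisfy the Coxeter relations. -/
lemma isLiftable_simpleReflection (hB : IsGeometric M B) :
    M.IsLiftable (simpleReflection hB) := by
  intro s t
  by_cases h0 : M s t = 0
  · rw [h0, pow_zero]
  by_cases hst : s = t
  · subst hst
    rw [M.diagonal, pow_one]
    ext1 x
    exact Module.involutive_reflection _ x
  have h1 : M s t ≠ 1 := M.off_diagonal s t hst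
  have hBst := hB.finite s t h0
  have hBts := hB.symm s t
  ext1 z
  rw [simpleReflection, simpleReflection,
    Module.reflection_mul_reflection_pow_apply _ _ (M s t) z _ rfl,
    hB.coroot_simpleRoot, hB.coroot_simpleRoot, ← hBts]
  generalize hm : M s t = m at *
  by_cases h2 : m = 2
  · subst h2
    have : B s t = 0 := by rw [hBst]; simp
    rw [this]
    norm_num
    abel
  have hm3 : (3 : ℝ) ≤ m := by exact_mod_cast (by omega : 3 ≤ m)
  set θ : ℝ := Real.pi / m with hθ
  have hmθ : m * θ = Real.pi := by rw [hθ]; field_simp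
  have ht : 2 * B s t * (2 * B s t) - 2 = 2 * Real.cos (2 * θ) := by
    rw [hBst, Real.cos_two_mul]; ring
  have hsin : Real.sin (2 * θ) ≠ 0 := by
    have hpos : 0 < θ := div_pos Real.pi_pos (by linarith)
    have : 3 * θ ≤ Real.pi := by rw [← hmθ]; gcongr
    exact (Real.sin_pos_of_pos_of_lt_pi (by linarith) (by linarith)).ne'
  rw [ht]
  have hS := fun n : ℤ => Polynomial.Chebyshev.S_two_mul_real_cos (2 * θ) n
  rcases Nat.even_or_odd' m with ⟨k, hk | hk⟩
  · have e1 : ((m : ℤ) - 2) / 2 = k - 1 := by omega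
    have e2 : ((m : ℤ) - 1) / 2 = k - 1 := by omega
    have : (Polynomial.Chebyshev.S ℝ ((k : ℤ) - 1)).eval (2 * Real.cos (2 * θ)) = 0 := by
      have h := hS ((k : ℤ) - 1)
      have e : (((k : ℤ) - 1 : ℤ) + 1 : ℝ) * (2 * θ) = Real.pi := by
        rw [← hmθ, hk]; push_cast; ring
      rw [e, Real.sin_pi] at h
      exact (mul_eq_zero.mp h).resolve_right hsin
    rw [e1, e2, this]
    simp
  · have e1 : ((m : ℤ) - 1) / 2 = k := by omega
    have e2 : ((m : ℤ) - 3) / 2 = k - 1 := by omega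
    have e3 : (m : ℤ) / 2 = k := by omega
    have e4 : ((m : ℤ) - 2) / 2 = k - 1 := by omega
    have : (Polynomial.Chebyshev.S ℝ (k : ℤ)).eval (2 * Real.cos (2 * θ)) +
        (Polynomial.Chebyshev.S ℝ ((k : ℤ) - 1)).eval (2 * Real.cos (2 * θ)) = 0 := by
      have h := hS (k : ℤ)
      have h' := hS ((k : ℤ) - 1)
      have e : (((k : ℤ) : ℝ) + 1) * (2 * θ) = Real.pi + θ := by
        rw [← hmθ, hk]; push_cast; ring
      have e' : (((k : ℤ) - 1 : ℤ) + 1 : ℝ) * (2 * θ) = Real.pi - θ := by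
        rw [← hmθ, hk]; push_cast; ring
      rw [e, add_comm, Real.sin_add_pi] at h
      rw [e', Real.sin_pi_sub] at h'
      refine (mul_eq_zero.mp ?_).resolve_right hsin
      rw [add_mul, h, h', neg_add_cancel]
    rw [e1, e2, e3, e4, this]
    simp

variable {W : Type*} [Group W]

/-- The geometric representation `ρ : W → GL(V)`, `s ↦ σ_{α_s}`. -/
def rho (cs : CoxeterSystem M W) (hB : IsGeometric M B) : W →* ((S → ℝ) ≃ₗ[ℝ] (S → ℝ)) :=
  cs.lift ⟨simpleReflection hB, isLiftable_simpleReflection hB⟩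

/-- The set `Φ` of roots, the orbit of the simple roots under `W`. -/
def roots (cs : CoxeterSystem M W) (hB : IsGeometric M B) : Set (S → ℝ) :=
  {γ | ∃ (w : W) (s : S), γ = rho cs hB w (simpleRoot s)}

/-- The positive roots: the roots with non-negative coordinates in the basis of simple roots. -/
def posRoots (cs : CoxeterSystem M W) (hB : IsGeometric M B) : Set (S → ℝ) :=
  {γ ∈ roots cs hB | ∀ s, 0 ≤ γ s}

/-- The set of limit roots: the accumulation points of the directions of roots. -/
def limitRoots (cs : CoxeterSystem M W) (hB : IsGeometric M B) : Set (ℙ ℝ (S → ℝ)) :=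
  derivedSet (proj (roots cs hB))

end Geometric

/-- The prefix `s_1 ... s_k` of an infinite word; the letter `s_{i+1}` is `a i`. -/
def wordPrefix {S : Type*} (a : ℕ → S) (k : ℕ) : List S := (List.range k).map a

/-- An infinite word is reduced if every finite prefix is a reduced expression. -/
def IsInfReduced {S W : Type*} [Group W] {M : CoxeterMatrix S} (cs : CoxeterSystem M W)
    (a : ℕ → S) : Prop :=
  ∀ k, cs.IsReduced (wordPrefix a k)

/-- The element `w_k = s_1 ... s_k` of `W`. -/
def prefixElt {S W : Type*} [Group W] {M : CoxeterMatrix S} (cs : CoxeterSystem M W)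
    (a : ℕ → S) (k : ℕ) : W :=
  cs.wordProd (wordPrefix a k)

/-- The inversion set of an infinite word: the positive roots `w_k(α_{s_{k+1}})`, `k ≥ 0`. -/
def invSet {M : CoxeterMatrix S} {B : Matrix S S ℝ} {W : Type*} [Group W]
    (cs : CoxeterSystem M W) (hB : IsGeometric M B) (a : ℕ → S) : Set (S → ℝ) :=
  {γ ∈ posRoots cs hB | ∃ k, γ = rho cs hB (prefixElt cs a k) (simpleRoot (a k))}

end

end GeomCox

/-!
The system of inequalities `B(e, α_s) < 0` has a timelike solution `e`: since `B` has non-positive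
off-diagonal entries, its lowest eigenvector may be taken non-negative (Perron–Frobenius), and a
small perturbation makes all the inequalities strict. No `w ≠ 1` maps `e` to another solution, so
the roots are discrete and closed: for two distinct nearby roots the product of the reflections
would move `e` only slightly. Along a reduced word `w_k(e)` increases coordinatewise, each step
adding a multiple, bounded below, of the inversion root `γ_k = w_k(α_{s_{k+1}})`; as the `γ_k` are
distinct roots, they and hence the `w_k(e)` tend to infinity.

Bounded vectors `y_k`, `z_k` have bounded products `B(w_k y_k, w_k z_k) = B(y_k, z_k)`, so limit
directions of diverging sequences `w_k y_k`, `w_k z_k` are isotropic and orthogonal to each other,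
hence equal because the form is Lorentzian. So every diverging `w_k z_k`, in particular `γ_k`, has
the limit directions of `w_k(e)`. These are all equal too: any two of them satisfy `B(u, v) ≥ 0`,
because `B(w_k(e), γ_j) ≥ 0` for `j < k` and `w_k(e) - e` is a non-negative combination of the
`γ_j`, whereas isotropic vectors in the same half of the light cone satisfy `B(u, v) ≤ 0`, with
equality only if they are proportional.
-/

namespace GeomCox

section LorentzForm

open Module

variable {𝕜 V : Type*} [Field 𝕜] [LinearOrder 𝕜] [AddCommGroup V] [Module 𝕜 V]
  {b : LinearMap.BilinForm 𝕜 V}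

lemma nondegenerate_of_forall_orthogonal_pos (hb : b.IsSymm) {e : V}
    (he : ∀ x ≠ 0, b e x = 0 → 0 < b x x) : b.Nondegenerate := by
  refine hb.isRefl.nondegenerate_iff_separatingLeft.2 fun x hx => ?_
  by_contra hx0
  exact (he x hx0 (by rw [hb.eq, hx])).ne' (hx x)

variable [IsStrictOrderedRing 𝕜]

lemma exists_apply_self_neg [FiniteDimensional 𝕜 V] (h : 0 < sigNeg b.toQuadraticMap) :
    ∃ e, b e e < 0 := by
  obtain ⟨N, hN, hneg⟩ := exists_finrank_eq_sigPos_and_posDef (-b.toQuadraticMap)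
  rw [sigPos_neg] at hN
  have : Nontrivial N := Module.nontrivial_of_finrank_pos (R := 𝕜) (by omega)
  obtain ⟨e, he⟩ := exists_ne (0 : N)
  exact ⟨e, by simpa using hneg e he⟩

lemma apply_self_pos_of_orthogonal_timelike [FiniteDimensional 𝕜 V] (hb : b.IsSymm)
    (hsig : finrank 𝕜 V ≤ sigPos b.toQuadraticMap + 1) {e x : V} (he : b e e < 0)
    (hex : b e x = 0) (hx : x ≠ 0) : 0 < b x x := by
  by_contra! hxx
  have independent : LinearIndependent 𝕜 ![e, x] := by
    refine LinearIndependent.pair_iff.2 fun c d hcd => ?_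
    have hc : c = 0 := by simpa [hex, he.ne] using congrArg (b e) hcd
    exact ⟨hc, by simpa [hc, hx] using hcd⟩
  have nonpos : ∀ v ∈ Submodule.span 𝕜 (Set.range ![e, x]), b.toQuadraticMap v ≤ 0 := by
    intro v hv
    rw [Matrix.range_cons_cons_empty, Submodule.mem_span_pair] at hv
    obtain ⟨c, d, rfl⟩ := hv
    have expand : b (c • e + d • x) (c • e + d • x) = c ^ 2 * b e e + d ^ 2 * b x x := by
      simp only [map_add, map_smul, LinearMap.add_apply, LinearMap.smul_apply, smul_eq_mul, hex,
        hb.eq x e]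
      ring
    rw [LinearMap.BilinMap.toQuadraticMap_apply, expand]
    exact add_nonpos (mul_nonpos_of_nonneg_of_nonpos (sq_nonneg c) he.le)
      (mul_nonpos_of_nonneg_of_nonpos (sq_nonneg d) hxx)
  have := QuadraticForm.sigPos_add_finrank_le_of_nonpos nonpos
  rw [finrank_span_eq_card independent, Fintype.card_fin] at this
  omega

lemma exists_pos_smul_eq_of_mk_eq_mk {x y : V} {hx : x ≠ 0} {hy : y ≠ 0}
    (h : Projectivization.mk 𝕜 x hx = Projectivization.mk 𝕜 y hy) {f : Dual 𝕜 V}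
    (hfx : f x < 0) (hfy : f y < 0) : ∃ c : 𝕜, 0 < c ∧ c • y = x := by
  obtain ⟨c, rfl⟩ := (Projectivization.mk_eq_mk_iff' 𝕜 x y hx hy).mp h
  rw [map_smul, smul_eq_mul] at hfx
  exact ⟨c, pos_of_mul_neg_left hfx hfy.le, rfl⟩

lemma mk_eq_mk_of_isotropic {b : LinearMap.BilinForm 𝕜 V} (hb : b.IsSymm) {e u v : V}
    (he : ∀ x ≠ 0, b e x = 0 → 0 < b x x) (hu : u ≠ 0) (hv : v ≠ 0)
    (huu : b u u = 0) (hvv : b v v = 0) (huv : 0 ≤ b e u * b e v * b u v) :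
    Projectivization.mk 𝕜 u hu = Projectivization.mk 𝕜 v hv := by
  have heu : b e u ≠ 0 := fun h => (he u hu h).ne' huu
  have orthogonal : b e (b e v • u - b e u • v) = 0 := by
    simp only [map_sub, map_smul, smul_eq_mul]; ring
  have norm : b (b e v • u - b e u • v) (b e v • u - b e u • v) =
      -(2 * (b e u * b e v * b u v)) := by
    simp only [map_sub, map_smul, LinearMap.sub_apply, LinearMap.smul_apply, smul_eq_mul,
      hb.eq v u, huu, hvv]
    ring
  have smul_eq : b e v • u = b e u • v := by
    by_contra h
    linarith [he _ (sub_ne_zero.mpr h) orthogonal]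
  rw [eq_comm, Projectivization.mk_eq_mk_iff']
  exact ⟨(b e u)⁻¹ * b e v, by rw [mul_smul, smul_eq, inv_smul_smul₀ heu]⟩

end LorentzForm

section PerronFrobenius

open Matrix

variable {n : Type*} [Fintype n]

lemma abs_dotProduct_mulVec_abs_le {A : Matrix n n ℝ} (hA : ∀ i j, i ≠ j → A i j ≤ 0) (x : n → ℝ) :
    |x| ⬝ᵥ A *ᵥ |x| ≤ x ⬝ᵥ A *ᵥ x := by
  simp only [dotProduct, mulVec, Finset.mul_sum, Pi.abs_apply]
  refine Finset.sum_le_sum fun i _ => Finset.sum_le_sum fun j _ => ?_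
  rw [mul_left_comm, ← abs_mul, mul_left_comm (x i)]
  rcases eq_or_ne i j with rfl | hij
  · rw [abs_mul_self]
  · exact mul_le_mul_of_nonpos_left (le_abs_self _) (hA i j hij)

lemma exists_mulVec_eq_smul_of_not_posSemidef [DecidableEq n] {A : Matrix n n ℝ}
    (hA : A.IsHermitian) (hneg : ¬ A.PosSemidef) :
    ∃ m : ℝ, m < 0 ∧ (A - m • (1 : Matrix n n ℝ)).PosSemidef ∧ ∃ x ≠ 0, A *ᵥ x = m • x := by
  rw [hA.posSemidef_iff_eigenvalues_nonneg] at hneg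
  obtain ⟨i₀, hi₀⟩ : ∃ i, hA.eigenvalues i < 0 := by simpa [Pi.le_def] using hneg
  have : Nonempty n := ⟨i₀⟩
  obtain ⟨i, hi⟩ := Finite.exists_min hA.eigenvalues
  refine ⟨hA.eigenvalues i, (hi i₀).trans_lt hi₀, ?_, _, fun h => ?_, hA.mulVec_eigenvectorBasis i⟩
  · rw [posSemidef_iff_isHermitian_and_spectrum_nonneg]
    refine ⟨hA.sub (isHermitian_one.smul (.all (hA.eigenvalues i))), ?_⟩
    rw [← Algebra.algebraMap_eq_smul_one, ← spectrum.sub_singleton_eq,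
      hA.spectrum_real_eq_range_eigenvalues]
    rintro _ ⟨_, ⟨j, rfl⟩, _, rfl, rfl⟩
    exact sub_nonneg.2 (hi j)
  · exact hA.eigenvectorBasis.orthonormal.ne_zero i (by simpa using h)

lemma exists_nonneg_mulVec_eq_smul {A : Matrix n n ℝ} (hA : A.IsHermitian)
    (hoff : ∀ i j, i ≠ j → A i j ≤ 0) (hneg : ¬ A.PosSemidef) :
    ∃ m : ℝ, m < 0 ∧ ∃ x, 0 ≤ x ∧ x ≠ 0 ∧ A *ᵥ x = m • x := by
  classical
  obtain ⟨m, hm, hpos, x, hx, hAx⟩ := exists_mulVec_eq_smul_of_not_posSemidef hA hneg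
  refine ⟨m, hm, |x|, abs_nonneg x, fun h => hx (funext fun i => abs_eq_zero.1 (congrFun h i)), ?_⟩
  have eigen_iff (y : n → ℝ) : A *ᵥ y = m • y ↔ (A - m • (1 : Matrix n n ℝ)) *ᵥ y = 0 := by
    rw [sub_mulVec, smul_mulVec, one_mulVec, sub_eq_zero]
  rw [eigen_iff, ← hpos.dotProduct_mulVec_zero_iff]
  refine le_antisymm ?_ (hpos.dotProduct_mulVec_nonneg _)
  calc |x| ⬝ᵥ (A - m • (1 : Matrix n n ℝ)) *ᵥ |x|
      ≤ x ⬝ᵥ (A - m • (1 : Matrix n n ℝ)) *ᵥ x :=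
        abs_dotProduct_mulVec_abs_le
          (fun i j hij => by simpa [one_apply_ne hij] using hoff i j hij) x
    _ = 0 := by rw [(eigen_iff x).1 hAx, dotProduct_zero]

end PerronFrobenius

section Antidominant

open Matrix Filter Topology
variable {S : Type*} [Fintype S] [DecidableEq S] {B : Matrix S S ℝ} {e x : S → ℝ}

/-- A vector is strictly antidominant if its product with every simple root is negative, that is,
if its negative lies in the interior of the fundamental chamber. -/
def IsStrictlyAntidominant (B : Matrix S S ℝ) (e : S → ℝ) : Prop :=
  ∀ s, form B e (simpleRoot s) < 0

lemma form_eq_dotProduct_mulVec (B : Matrix S S ℝ) (x y : S → ℝ) : form B x y = x ⬝ᵥ B *ᵥ y :=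
  Matrix.toBilin'_apply' B x y

lemma isHermitian_iff_form_isSymm : B.IsHermitian ↔ (form B).IsSymm := by
  rw [form, Matrix.isSymm_toBilin'_iff_isSymm]; rfl

lemma form_eq_sum (B : Matrix S S ℝ) (x y : S → ℝ) :
    form B x y = ∑ s, y s * form B x (simpleRoot s) := by
  conv_lhs => rw [pi_eq_sum_univ' y]
  simp [simpleRoot]

lemma IsStrictlyAntidominant.form_nonpos (he : IsStrictlyAntidominant B e) (hx : 0 ≤ x) :
    form B e x ≤ 0 := by
  rw [form_eq_sum]
  exact Finset.sum_nonpos fun s _ => mul_nonpos_of_nonneg_of_nonpos (hx s) (he s).le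

lemma IsStrictlyAntidominant.form_neg (he : IsStrictlyAntidominant B e) (hx : 0 ≤ x) (hx0 : x ≠ 0) :
    form B e x < 0 := by
  obtain ⟨s, hs⟩ := (Pi.lt_def.1 (hx.lt_of_ne' hx0)).2
  rw [form_eq_sum]
  exact Finset.sum_neg' (fun t _ => mul_nonpos_of_nonneg_of_nonpos (hx t) (he t).le)
    ⟨s, Finset.mem_univ s, mul_neg_of_pos_of_neg hs (he s)⟩

lemma not_posSemidef_of_form_self_neg (h : form B e e < 0) : ¬ B.PosSemidef := fun hB =>
  h.not_ge (by simpa [form_eq_dotProduct_mulVec] using hB.dotProduct_mulVec_nonneg e)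

lemma exists_isStrictlyAntidominant_of_nondegenerate (hnd : (form B).Nondegenerate) :
    ∃ y, IsStrictlyAntidominant B y :=
  ⟨-((form B).toDual hnd).symm (∑ s, LinearMap.proj s), fun s => by
    rw [map_neg, LinearMap.neg_apply, LinearMap.BilinForm.apply_toDual_symm_apply]
    simp [simpleRoot, Pi.single_apply]⟩

lemma form_simpleRoot_eq_mulVec (hB : B.IsHermitian) (x : S → ℝ) (s : S) :
    form B x (simpleRoot s) = (B *ᵥ x) s := by
  rw [← (isHermitian_iff_form_isSymm.1 hB).eq]
  simp [form_eq_dotProduct_mulVec, simpleRoot]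

lemma exists_isStrictlyAntidominant_form_self_neg (hB : B.IsHermitian)
    (hoff : ∀ s t, s ≠ t → B s t ≤ 0) (hneg : ¬ B.PosSemidef) (hnd : (form B).Nondegenerate) :
    ∃ e, IsStrictlyAntidominant B e ∧ form B e e < 0 := by
  obtain ⟨m, hm, z, hz, hz0, hBz⟩ := exists_nonneg_mulVec_eq_smul hB hoff hneg
  obtain ⟨y, hy⟩ := exists_isStrictlyAntidominant_of_nondegenerate hnd
  have antidominant {ε : ℝ} (hε : 0 < ε) : IsStrictlyAntidominant B (z + ε • y) := fun s => by
    rw [map_add, map_smul, LinearMap.add_apply, form_simpleRoot_eq_mulVec hB, hBz]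
    exact add_neg_of_nonpos_of_neg (mul_nonpos_of_nonpos_of_nonneg hm.le (hz s))
      (mul_neg_of_pos_of_neg hε (hy s))
  have timelike : form B z z < 0 := by
    rw [form_eq_dotProduct_mulVec, hBz, dotProduct_smul]
    exact mul_neg_of_neg_of_pos hm (dotProduct_self_star_pos_iff.2 hz0)
  have continuous : Continuous fun ε : ℝ => form B (z + ε • y) (z + ε • y) := by
    simp only [map_add, map_smul, LinearMap.add_apply, LinearMap.smul_apply]
    fun_prop
  have eventually_timelike : ∀ᶠ ε : ℝ in 𝓝 0, form B (z + ε • y) (z + ε • y) < 0 :=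
    continuous.tendsto' 0 _ rfl (Iio_mem_nhds (by simpa using timelike))
  obtain ⟨ε, hε_neg, hε⟩ := ((eventually_timelike.filter_mono nhdsWithin_le_nhds).and
    self_mem_nhdsWithin).exists (f := 𝓝[>] 0)
  exact ⟨_, antidominant hε, hε_neg⟩

end Antidominant

section ProjectiveSpace

open Filter Topology
variable {S : Type*}

lemma continuous_mk' : Continuous (Projectivization.mk' ℝ : {x : S → ℝ // x ≠ 0} → ℙ ℝ (S → ℝ)) :=
  continuous_coinduced_rng

lemma isOpenQuotientMap_mk' :
    IsOpenQuotientMap (Projectivization.mk' ℝ : {x : S → ℝ // x ≠ 0} → ℙ ℝ (S → ℝ)) := by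
  refine ⟨Quotient.mk''_surjective, continuous_mk', fun U hU => isOpen_coinduced.2 ?_⟩
  have saturation_eq : Projectivization.mk' ℝ ⁻¹' (Projectivization.mk' ℝ '' U) =
      ⋃ c : ℝˣ, (fun x : {x : S → ℝ // x ≠ 0} =>
        (⟨c • x.1, (smul_ne_zero_iff_ne c).2 x.2⟩ : {x : S → ℝ // x ≠ 0})) ⁻¹' U := by
    ext y
    simp only [Set.mem_preimage, Set.mem_image, Set.mem_iUnion,
      Projectivization.mk'_eq_mk, Projectivization.mk_eq_mk_iff]
    constructor
    · rintro ⟨x, hx, c, hc⟩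
      exact ⟨c, by simpa only [hc] using hx⟩
    · rintro ⟨c, hc⟩
      exact ⟨_, hc, c, rfl⟩
  rw [saturation_eq]
  exact isOpen_iUnion fun c => hU.preimage (by fun_prop)

lemma mk_eq_mk_iff_forall_mul_eq_mul {K ι : Type*} [Field K] {x y : ι → K}
    (hx : x ≠ 0) (hy : y ≠ 0) :
    Projectivization.mk K x hx = Projectivization.mk K y hy ↔ ∀ i j, x i * y j = x j * y i := by
  rw [Projectivization.mk_eq_mk_iff']
  constructor
  · rintro ⟨c, rfl⟩ i j
    simp only [Pi.smul_apply, smul_eq_mul]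
    ring
  · intro h
    obtain ⟨j, hj⟩ := Function.ne_iff.1 hy
    refine ⟨x j / y j, funext fun i => ?_⟩
    rw [Pi.smul_apply, smul_eq_mul, div_mul_eq_mul_div, ← h i j, mul_div_cancel_right₀ _ hj]

instance : T2Space (ℙ ℝ (S → ℝ)) := by
  rw [t2Space_iff_of_isOpenQuotientMap isOpenQuotientMap_mk']
  simp only [Projectivization.mk'_eq_mk, mk_eq_mk_iff_forall_mul_eq_mul, Set.ofPred_forall]
  have continuous_coord (i : S) : Continuous fun x : {x : S → ℝ // x ≠ 0} => x.1 i :=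
    (continuous_apply i).comp continuous_subtype_val
  exact isClosed_iInter fun i => isClosed_iInter fun j => isClosed_eq
    (((continuous_coord i).comp continuous_fst).mul ((continuous_coord j).comp continuous_snd))
    (((continuous_coord j).comp continuous_fst).mul ((continuous_coord i).comp continuous_snd))

lemma tendsto_mk {ι : Type*} {l : Filter ι} {x : ι → S → ℝ} {u : S → ℝ} (hx : ∀ i, x i ≠ 0)
    (hu : u ≠ 0) (h : Tendsto x l (𝓝 u)) :
    Tendsto (fun i => Projectivization.mk ℝ (x i) (hx i)) l (𝓝 (Projectivization.mk ℝ u hu)) :=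
  (continuous_mk'.tendsto ⟨u, hu⟩).comp
    (f := fun i => ⟨x i, hx i⟩) (tendsto_subtype_rng.2 h)

lemma derivedSet_range_of_tendsto {ι X : Type*} [Infinite ι] [TopologicalSpace X] [T2Space X]
    {f : ι → X} {x : X} (hf : f.Injective) (h : Tendsto f cofinite (𝓝 x)) :
    derivedSet (Set.range f) = {x} := by
  refine Set.Subset.antisymm (fun z hz => ?_) (Set.singleton_subset_iff.2 ?_)
  · have : (comap f (𝓝[≠] z)).NeBot := by
      rwa [← map_neBot_iff f, map_comap]
    have le_cofinite : comap f (𝓝[≠] z) ≤ cofinite :=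
      (comap_mono (nhdsNE_le_cofinite z)).trans (comap_cofinite_le f)
    exact tendsto_nhds_unique (tendsto_comap.mono_right nhdsWithin_le_nhds)
      (h.mono_left le_cofinite)
  · have tendsto_punctured : Tendsto f cofinite (𝓝[≠] x) :=
      tendsto_nhdsWithin_iff.2 ⟨h, hf.tendsto_cofinite.eventually (eventually_cofinite_ne x)⟩
    exact NeBot.mono (map_neBot (f := cofinite))
      (le_inf tendsto_punctured (le_principal_iff.2 range_mem_map))

end ProjectiveSpace

section Divergence

open Filter Topology

variable {ι E : Type*} [NormedAddCommGroup E] [NormedSpace ℝ E] {x y : ι → E}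
  {l : Filter ι} {u v : E}

/-- The family `x` diverges to infinity along `l` and its directions `x i / ‖x i‖` tend to `u`. -/
structure DivergesInDirection (x : ι → E) (l : Filter ι) (u : E) : Prop where
  tendsto_norm : Tendsto (fun i => ‖x i‖) l atTop
  tendsto_normalized : Tendsto (fun i => ‖x i‖⁻¹ • x i) l (𝓝 u)

lemma exists_divergesInDirection [ProperSpace E] {U : Ultrafilter ι}
    (h : Tendsto (fun i => ‖x i‖) U atTop) : ∃ u, DivergesInDirection x U u := by
  have normalized_mem (i : ι) : ‖x i‖⁻¹ • x i ∈ Metric.closedBall (0 : E) 1 := by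
    rw [mem_closedBall_zero_iff, norm_smul, norm_inv, norm_norm]
    exact inv_mul_le_one
  obtain ⟨u, -, hu⟩ := (isCompact_closedBall (0 : E) 1).ultrafilter_le_nhds'
    (U.map fun i => ‖x i‖⁻¹ • x i) (Filter.mem_map.2 (Eventually.of_forall normalized_mem))
  exact ⟨u, h, hu⟩

namespace DivergesInDirection

lemma comp (h : DivergesInDirection x l u) {ι' : Type*} {l' : Filter ι'} {ψ : ι' → ι}
    (hψ : Tendsto ψ l' l) : DivergesInDirection (fun i => x (ψ i)) l' u :=
  ⟨h.tendsto_norm.comp hψ, h.tendsto_normalized.comp hψ⟩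

lemma norm_eq_one [l.NeBot] (h : DivergesInDirection x l u) : ‖u‖ = 1 := by
  refine tendsto_nhds_unique_of_eventuallyEq h.tendsto_normalized.norm tendsto_const_nhds ?_
  filter_upwards [h.tendsto_norm.eventually_gt_atTop 0] with i hi
  rw [norm_smul, norm_inv, norm_norm, inv_mul_cancel₀ hi.ne']

lemma ne_zero [l.NeBot] (h : DivergesInDirection x l u) : u ≠ 0 :=
  norm_ne_zero_iff.1 (h.norm_eq_one.trans_ne one_ne_zero)

lemma apply_nonneg_of_le [FiniteDimensional ℝ E] [l.NeBot] (h : DivergesInDirection x l u)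
    {f : Module.Dual ℝ E} {C : ℝ} (hf : ∀ᶠ i in l, C ≤ f (x i)) : 0 ≤ f u := by
  have lower : Tendsto (fun i => ‖x i‖⁻¹ * C) l (𝓝 0) := by
    simpa using h.tendsto_norm.inv_tendsto_atTop.mul_const C
  refine le_of_tendsto_of_tendsto lower
    ((f.continuous_of_finiteDimensional.tendsto u).comp h.tendsto_normalized) ?_
  filter_upwards [hf] with i hi
  rw [Function.comp_apply, map_smul, smul_eq_mul]
  exact mul_le_mul_of_nonneg_left hi (inv_nonneg.2 (norm_nonneg _))

lemma bilin_eq_zero [FiniteDimensional ℝ E] [l.NeBot] (hx : DivergesInDirection x l u)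
    (hy : DivergesInDirection y l v) {b : LinearMap.BilinForm ℝ E} {C : ℝ}
    (hb : ∀ᶠ i in l, |b (x i) (y i)| ≤ C) :
    b u v = 0 := by
  have inv_tendsto : Tendsto (fun i => ‖x i‖⁻¹ * ‖y i‖⁻¹) l (𝓝 0) := by
    simpa using hx.tendsto_norm.inv_tendsto_atTop.mul hy.tendsto_norm.inv_tendsto_atTop
  have normalized : Tendsto (fun i => b (‖x i‖⁻¹ • x i) (‖y i‖⁻¹ • y i)) l (𝓝 (b u v)) :=
    (b.toContinuousBilinearMap.continuous₂.tendsto (u, v)).comp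
      (hx.tendsto_normalized.prodMk_nhds hy.tendsto_normalized)
  refine tendsto_nhds_unique normalized ?_
  have zero := inv_tendsto.zero_mul_isBoundedUnder_le (g := fun i => b (x i) (y i))
    ⟨C, by simpa using hb⟩
  simpa [mul_assoc, mul_left_comm] using zero

lemma tendsto_mk {S : Type*} [Fintype S] {x : ι → S → ℝ} {u : S → ℝ} (h : DivergesInDirection x l u)
    (hx : ∀ i, x i ≠ 0) (hu : u ≠ 0) :
    Tendsto (fun i => Projectivization.mk ℝ (x i) (hx i)) l (𝓝 (Projectivization.mk ℝ u hu)) := by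
  have normalized_ne_zero (i : ι) : ‖x i‖⁻¹ • x i ≠ 0 :=
    smul_ne_zero (inv_ne_zero (norm_ne_zero_iff.2 (hx i))) (hx i)
  refine (GeomCox.tendsto_mk normalized_ne_zero hu h.tendsto_normalized).congr fun i => ?_
  rw [Projectivization.mk_eq_mk_iff']
  exact ⟨_, rfl⟩

end DivergesInDirection

end Divergence

section AlternatingWord

open CoxeterSystem

variable {S W : Type*} [Group W] {M : CoxeterMatrix S} (cs : CoxeterSystem M W)

lemma exists_eq_mul_wordProd_alternatingWord (w : W) (s t : S) (hs : ¬ cs.IsRightDescent w s) :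
    ∃ v k, w = v * cs.wordProd (alternatingWord s t k) ∧ cs.length v + k = cs.length w ∧
      ¬ cs.IsRightDescent v s ∧ ¬ cs.IsRightDescent v t := by
  induction hn : cs.length w generalizing w s t with
  | zero =>
    rw [cs.length_eq_zero_iff] at hn
    exact ⟨w, 0, by simp [alternatingWord], by simp [hn], hs,
      by simp [hn, cs.not_isRightDescent_one]⟩
  | succ n ih =>
    by_cases ht : cs.IsRightDescent w t
    · have length_eq : cs.length (w * cs.simple t) = n := by
        rw [cs.isRightDescent_iff] at ht; omega
      obtain ⟨v, k, hw, hk, hvt, hvs⟩ :=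
        ih (w * cs.simple t) t s (cs.isRightDescent_iff_not_isRightDescent_mul.1 ht) length_eq
      refine ⟨v, k + 1, ?_, by omega, hvs, hvt⟩
      rw [alternatingWord_succ, cs.wordProd_concat, ← mul_assoc, ← hw,
        cs.simple_mul_simple_cancel_right]
    · exact ⟨w, 0, by simp [alternatingWord], by simp [hn], hs, ht⟩

lemma lt_of_not_isRightDescent_mul_alternatingWord {v w : W} {s t : S} {k : ℕ} (h0 : M s t ≠ 0)
    (hw : w = v * cs.wordProd (alternatingWord s t k)) (hk : cs.length v + k = cs.length w)
    (hs : ¬ cs.IsRightDescent w s) : k < M s t := by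
  by_contra! hle
  rw [M.symmetric] at h0 hle
  refine cs.not_isReduced_alternatingWord t s h0 (Nat.lt_succ_of_le hle) ?_
  have mul_simple : w * cs.simple s = v * cs.wordProd (alternatingWord t s (k + 1)) := by
    rw [alternatingWord_succ, cs.wordProd_concat, ← mul_assoc, ← hw]
  have lower := cs.length_mul_le v (cs.wordProd (alternatingWord t s (k + 1)))
  have upper := cs.length_wordProd_le (alternatingWord t s (k + 1))
  rw [← mul_simple, cs.not_isRightDescent_iff.1 hs] at lower
  rw [length_alternatingWord] at upper
  rw [CoxeterSystem.IsReduced, Nat.succ_eq_add_one, length_alternatingWord]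
  omega

end AlternatingWord

section RankTwo

open Polynomial.Chebyshev

lemma eval_S_nonneg_and_le_succ {R : Type*} [CommRing R] [LinearOrder R] [IsStrictOrderedRing R]
    {x : R} (hx : 2 ≤ x) (n : ℕ) :
    0 ≤ (S R (n - 1)).eval x ∧ (S R (n - 1)).eval x ≤ (S R n).eval x := by
  induction n with
  | zero => simp
  | succ n ih =>
    obtain ⟨nonneg, le⟩ := ih
    push_cast
    rw [add_sub_cancel_right, S_add_one, Polynomial.eval_sub, Polynomial.eval_mul,
      Polynomial.eval_X]
    exact ⟨nonneg.trans le, by nlinarith [mul_le_mul_of_nonneg_right hx (nonneg.trans le)]⟩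

lemma eval_S_two_mul_cos_pi_div_nonneg {m n : ℕ} (hm : 2 ≤ m) (hn : n ≤ m) :
    0 ≤ (S ℝ (n - 1)).eval (2 * Real.cos (Real.pi / m)) := by
  have hm' : (2 : ℝ) ≤ m := by exact_mod_cast hm
  have sin_pos : 0 < Real.sin (Real.pi / m) :=
    Real.sin_pos_of_pos_of_lt_pi (by positivity) (div_lt_self Real.pi_pos (by linarith))
  refine nonneg_of_mul_nonneg_left ?_ sin_pos
  rw [S_two_mul_real_cos]
  push_cast
  rw [sub_add_cancel]
  refine Real.sin_nonneg_of_nonneg_of_le_pi (by positivity) ?_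
  calc (n : ℝ) * (Real.pi / m) ≤ m * (Real.pi / m) := by gcongr
    _ = Real.pi := by field_simp

variable {S : Type*} {M : CoxeterMatrix S} {B : Matrix S S ℝ}

lemma IsGeometric.eval_S_nonneg (hB : IsGeometric M B) {s t : S} (hst : s ≠ t) {n : ℕ}
    (hn : M s t ≠ 0 → n ≤ M s t) :
    0 ≤ (Polynomial.Chebyshev.S ℝ (n - 1)).eval (-2 * B s t) := by
  by_cases h0 : M s t = 0
  · exact (eval_S_nonneg_and_le_succ (by linarith [hB.infinite s t h0]) n).1
  · have hm : 2 ≤ M s t := by have := M.off_diagonal s t hst; omega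
    simpa [hB.finite s t h0] using eval_S_two_mul_cos_pi_div_nonneg hm (hn h0)

lemma IsGeometric.apply_nonpos (hB : IsGeometric M B) {s t : S} (hst : s ≠ t) : B s t ≤ 0 := by
  have h := hB.eval_S_nonneg hst (n := 2) fun h0 => by have := M.off_diagonal s t hst; omega
  norm_num at h
  linarith

lemma IsGeometric.isHermitian (hB : IsGeometric M B) : B.IsHermitian :=
  Matrix.IsHermitian.ext fun s t => hB.symm t s

lemma IsGeometric.isSymm_form [Fintype S] [DecidableEq S] (hB : IsGeometric M B) :
    (form B).IsSymm :=
  isHermitian_iff_form_isSymm.1 hB.isHermitian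

end RankTwo

section Representation

open CoxeterSystem

variable {S W : Type*} [Fintype S] [DecidableEq S] [Group W] {M : CoxeterMatrix S}
  {B : Matrix S S ℝ} (cs : CoxeterSystem M W) (hB : IsGeometric M B)

lemma rho_simple_apply (s : S) (x : S → ℝ) :
    rho cs hB (cs.simple s) x = x - (2 * form B x (simpleRoot s)) • simpleRoot s := by
  rw [rho, cs.lift_apply_simple, simpleReflection_apply, form_simpleRoot, hB.diag, div_one]

lemma rho_simple_simpleRoot (s : S) : rho cs hB (cs.simple s) (simpleRoot s) = -simpleRoot s := by
  rw [rho_simple_apply, form_simpleRoot, hB.diag]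
  module

lemma form_rho (w : W) (x y : S → ℝ) :
    form B (rho cs hB w x) (rho cs hB w y) = form B x y := by
  induction w using cs.simple_induction generalizing x y with
  | simple s =>
    simp only [rho_simple_apply, map_sub, map_smul, LinearMap.sub_apply, LinearMap.smul_apply,
      smul_eq_mul, form_simpleRoot, hB.diag, hB.isSymm_form.eq y (simpleRoot s)]
    ring
  | one => simp
  | mul v w hv hw => rw [map_mul, LinearEquiv.mul_apply, LinearEquiv.mul_apply, hv, hw]

lemma form_rho_left (w : W) (x y : S → ℝ) :
    form B (rho cs hB w x) y = form B x (rho cs hB w⁻¹ y) := by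
  rw [← form_rho cs hB w x, ← LinearEquiv.mul_apply, ← map_mul, mul_inv_cancel, map_one,
    LinearEquiv.coe_one, id]

lemma rho_alternatingWord (s t : S) (k : ℕ) :
    rho cs hB (cs.wordProd (alternatingWord s t k)) (simpleRoot s) =
      (Polynomial.Chebyshev.S ℝ k).eval (-2 * B s t) • simpleRoot (if Even k then s else t) +
      (Polynomial.Chebyshev.S ℝ (k - 1)).eval (-2 * B s t) •
        simpleRoot (if Even k then t else s) := by
  induction k with
  | zero => simp [alternatingWord]
  | succ k ih =>
    rw [alternatingWord_succ', cs.wordProd_cons, map_mul, LinearEquiv.mul_apply, ih, map_add,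
      map_smul, map_smul, rho_simple_simpleRoot, rho_simple_apply, form_simpleRoot]
    push_cast
    rw [add_sub_cancel_right, Polynomial.Chebyshev.S_add_one, Polynomial.eval_sub,
      Polynomial.eval_mul, Polynomial.eval_X]
    by_cases hk : Even k
    · simp only [hk, if_true, Nat.even_add_one, not_true, if_false]
      module
    · simp only [hk, if_false, Nat.even_add_one, not_false_eq_true, if_true, hB.symm t s]
      module

lemma rho_simpleRoot_nonneg (w : W) (s : S) (hs : ¬ cs.IsRightDescent w s) :
    0 ≤ rho cs hB w (simpleRoot s) := by
  induction hn : cs.length w using Nat.strong_induction_on generalizing w s with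
  | _ n ih =>
  rcases eq_or_ne w 1 with rfl | hw1
  · simp [simpleRoot]
  obtain ⟨t, ht⟩ := cs.exists_rightDescent_of_ne_one hw1
  have hst : s ≠ t := fun h => hs (h ▸ ht)
  obtain ⟨v, k, hw, hk, hvs, hvt⟩ := exists_eq_mul_wordProd_alternatingWord cs w s t hs
  have hkM (h0 : M s t ≠ 0) : k < M s t :=
    lt_of_not_isRightDescent_mul_alternatingWord cs h0 hw hk hs
  have length_lt : cs.length v < n := by
    have hk0 : k ≠ 0 := by
      rintro rfl
      exact hvt (by simpa [hw, alternatingWord] using ht)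
    omega
  have coeff : 0 ≤ (Polynomial.Chebyshev.S ℝ k).eval (-2 * B s t) := by
    simpa using hB.eval_S_nonneg hst (n := k + 1) hkM
  have coeff' := hB.eval_S_nonneg hst (n := k) fun h0 => (hkM h0).le
  have nonneg_s := ih _ length_lt v s hvs rfl
  have nonneg_t := ih _ length_lt v t hvt rfl
  rw [hw, map_mul, LinearEquiv.mul_apply, rho_alternatingWord, map_add, map_smul, map_smul]
  refine add_nonneg (smul_nonneg coeff ?_) (smul_nonneg coeff' ?_) <;> split_ifs <;> assumption

lemma rho_simpleRoot_nonpos (w : W) (s : S) (hs : cs.IsRightDescent w s) :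
    rho cs hB w (simpleRoot s) ≤ 0 := by
  have h := rho_simpleRoot_nonneg cs hB _ s (cs.isRightDescent_iff_not_isRightDescent_mul.1 hs)
  rwa [map_mul, LinearEquiv.mul_apply, rho_simple_simpleRoot, map_neg, neg_nonneg] at h

end Representation

section Lorentzian

variable {S : Type*} [Fintype S] [DecidableEq S] {B : Matrix S S ℝ} {e x : S → ℝ}

lemma IsLorentzian.form_self_pos (hL : IsLorentzian B) (hB : B.IsHermitian) (he : form B e e < 0)
    (hx : x ≠ 0) (hex : form B e x = 0) : 0 < form B x x :=
  apply_self_pos_of_orthogonal_timelike (isHermitian_iff_form_isSymm.1 hB)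
    (by rw [Module.finrank_fintype_fun_eq_card, hL.1]) he hex hx

lemma IsLorentzian.exists_isStrictlyAntidominant_form_self_neg (hL : IsLorentzian B)
    (hB : B.IsHermitian) (hoff : ∀ s t, s ≠ t → B s t ≤ 0) :
    ∃ e, IsStrictlyAntidominant B e ∧ form B e e < 0 := by
  obtain ⟨e, he⟩ := exists_apply_self_neg (b := form B) (by rw [hL.2]; exact one_pos)
  exact GeomCox.exists_isStrictlyAntidominant_form_self_neg hB hoff
    (not_posSemidef_of_form_self_neg he)
    (nondegenerate_of_forall_orthogonal_pos (isHermitian_iff_form_isSymm.1 hB)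
      fun _ => hL.form_self_pos hB he)

end Lorentzian

section Reflection

variable {S : Type*} [Fintype S] [DecidableEq S] {B : Matrix S S ℝ} {e x β : S → ℝ}

lemma continuous_form (B : Matrix S S ℝ) : Continuous fun p : (S → ℝ) × (S → ℝ) => form B p.1 p.2 :=
  (form B).toContinuousBilinearMap.continuous₂

/-- The formula `x ↦ x - 2 B(x, β) β`; it is the reflection in `β` only when `B(β, β) = 1`, as for
all roots. -/
def reflection (B : Matrix S S ℝ) (β x : S → ℝ) : S → ℝ := x - (2 * form B x β) • β

lemma reflection_self (hβ : form B β β = 1) : reflection B β β = -β := by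
  rw [reflection, hβ]
  module

lemma reflection_reflection (hβ : form B β β = 1) (x : S → ℝ) :
    reflection B β (reflection B β x) = x := by
  simp only [reflection, map_sub, map_smul, LinearMap.sub_apply, LinearMap.smul_apply, smul_eq_mul,
    hβ]
  module

lemma continuous_reflection (B : Matrix S S ℝ) :
    Continuous fun p : (S → ℝ) × (S → ℝ) => reflection B p.1 p.2 :=
  continuous_snd.sub ((continuous_const.mul ((continuous_form B).comp continuous_swap)).smul
    continuous_fst)

lemma isOpen_setOf_isStrictlyAntidominant (B : Matrix S S ℝ) :
    IsOpen {e | IsStrictlyAntidominant B e} := by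
  simp only [IsStrictlyAntidominant, Set.ofPred_forall]
  exact isOpen_iInter_of_finite fun s => isOpen_lt
    ((form B).flip (simpleRoot s)).continuous_of_finiteDimensional continuous_const

end Reflection

section Roots

open Filter Topology

variable {S W : Type*} [Fintype S] [DecidableEq S] [Group W] {M : CoxeterMatrix S}
  {B : Matrix S S ℝ} {cs : CoxeterSystem M W} {hB : IsGeometric M B} {e β β' : S → ℝ}

lemma IsStrictlyAntidominant.eq_one_of_rho (he : IsStrictlyAntidominant B e) {w : W}
    (hwe : IsStrictlyAntidominant B (rho cs hB w e)) : w = 1 := by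
  by_contra hw
  obtain ⟨s, hs⟩ := cs.exists_leftDescent_of_ne_one hw
  have nonpos := rho_simpleRoot_nonpos cs hB w⁻¹ s (cs.isRightDescent_inv_iff.2 hs)
  have := he.form_nonpos (neg_nonneg.2 nonpos)
  rw [map_neg, ← form_rho_left] at this
  linarith [hwe s]

lemma form_self_of_mem_roots (hβ : β ∈ roots cs hB) : form B β β = 1 := by
  obtain ⟨w, s, rfl⟩ := hβ
  rw [form_rho, form_simpleRoot, hB.diag]

lemma ne_zero_of_mem_roots (hβ : β ∈ roots cs hB) : β ≠ 0 := by
  rintro rfl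
  simpa using form_self_of_mem_roots hβ

lemma rho_mem_roots (w : W) (hβ : β ∈ roots cs hB) : rho cs hB w β ∈ roots cs hB := by
  obtain ⟨w', s, rfl⟩ := hβ
  exact ⟨w * w', s, by rw [map_mul, LinearEquiv.mul_apply]⟩

lemma exists_rho_eq_reflection (hβ : β ∈ roots cs hB) : ∃ w, rho cs hB w = reflection B β := by
  obtain ⟨w, s, rfl⟩ := hβ
  refine ⟨w * cs.simple s * w⁻¹, funext fun x => ?_⟩
  rw [map_mul, map_mul, LinearEquiv.mul_apply, LinearEquiv.mul_apply, rho_simple_apply, map_sub,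
    map_smul, form_rho_left, inv_inv, ← LinearEquiv.mul_apply, ← map_mul, mul_inv_cancel, map_one,
    LinearEquiv.coe_one, id, reflection]

lemma eq_of_isStrictlyAntidominant_reflection_reflection (he : IsStrictlyAntidominant B e)
    (hβ : β ∈ roots cs hB) (hβ' : β' ∈ roots cs hB) (hpos : 0 < form B β' β)
    (h : IsStrictlyAntidominant B (reflection B β (reflection B β' e))) : β = β' := by
  obtain ⟨w, hw⟩ := exists_rho_eq_reflection hβ
  obtain ⟨w', hw'⟩ := exists_rho_eq_reflection hβ'
  have mul_eq_one : w * w' = 1 := he.eq_one_of_rho (cs := cs) (hB := hB) <| by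
    rwa [map_mul, LinearEquiv.mul_apply, hw, hw']
  have fixed : reflection B β (reflection B β' β') = β' := by
    rw [← hw, ← hw', ← LinearEquiv.mul_apply, ← map_mul, mul_eq_one, map_one,
      LinearEquiv.coe_one, id]
  have proportional : β' = form B β' β • β := by
    rw [reflection_self (form_self_of_mem_roots hβ'), reflection, map_neg,
      LinearMap.neg_apply] at fixed
    linear_combination (norm := module) (-1 / 2 : ℝ) • fixed
  have sq_eq_one : form B β' β ^ 2 = 1 := by
    rw [sq, ← smul_eq_mul, ← map_smul, ← proportional, form_self_of_mem_roots hβ']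
  rw [proportional, (pow_eq_one_iff_of_nonneg hpos.le two_ne_zero).1 sq_eq_one, one_smul]

variable (cs hB) in
lemma eventually_roots_eq (he : IsStrictlyAntidominant B e) (x : S → ℝ) :
    ∀ᶠ p in 𝓝 (x, x), p.1 ∈ roots cs hB → p.2 ∈ roots cs hB → p.1 = p.2 := by
  have form_tendsto : Tendsto (fun p : (S → ℝ) × (S → ℝ) => form B p.2 p.1) (𝓝 (x, x))
      (𝓝 (form B x x)) :=
    ((continuous_form B).comp continuous_swap).tendsto (x, x)
  have form_self_tendsto : Tendsto (fun p : (S → ℝ) × (S → ℝ) => form B p.1 p.1) (𝓝 (x, x))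
      (𝓝 (form B x x)) :=
    ((continuous_form B).comp (continuous_fst.prodMk continuous_fst)).tendsto (x, x)
  rcases ne_or_eq (form B x x) 1 with hx | hx
  · filter_upwards [form_self_tendsto.eventually_ne hx] with p hp hp1
    exact absurd (form_self_of_mem_roots hp1) hp
  have reflections_tendsto : Tendsto (fun p => reflection B p.1 (reflection B p.2 e)) (𝓝 (x, x))
      (𝓝 e) :=
    ((continuous_reflection B).comp (continuous_fst.prodMk
      ((continuous_reflection B).comp (continuous_snd.prodMk continuous_const)))).tendsto' _ _
      (reflection_reflection hx e)
  filter_upwards [form_tendsto.eventually_const_lt (hx ▸ one_pos),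
    reflections_tendsto.eventually
      ((isOpen_setOf_isStrictlyAntidominant B).mem_nhds he)] with p hpos hanti h1 h2
  exact eq_of_isStrictlyAntidominant_reflection_reflection he h1 h2 hpos hanti

lemma disjoint_nhdsNE_roots (he : IsStrictlyAntidominant B e) (x : S → ℝ) :
    Disjoint (𝓝[≠] x) (𝓟 (roots cs hB)) := by
  rw [disjoint_iff]
  by_contra h
  have : (𝓝[≠] x ⊓ 𝓟 (roots cs hB)).NeBot := ⟨h⟩
  set F := 𝓝[≠] x ⊓ 𝓟 (roots cs hB)
  have le_nhds : F ≤ 𝓝 x := inf_le_left.trans nhdsWithin_le_nhds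
  have mem_roots : ∀ᶠ β in F, β ∈ roots cs hB := Filter.mem_inf_of_right (mem_principal_self _)
  have ne : ∀ᶠ β in F, β ≠ x := Filter.mem_inf_of_left self_mem_nhdsWithin
  have eq : ∀ᶠ β in F, ∀ᶠ β' in F, β ∈ roots cs hB → β' ∈ roots cs hB → β = β' :=
    ((eventually_roots_eq cs hB he x).filter_mono
      (by rw [nhds_prod_eq]; exact prod_mono le_nhds le_nhds)).curry
  obtain ⟨β, hβ, hβx, hβF⟩ := (mem_roots.and (ne.and eq)).exists
  obtain ⟨β', hβ', heq, hne⟩ := (mem_roots.and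
    (hβF.and (le_nhds (eventually_ne_nhds hβx.symm)))).exists
  exact hne (heq hβ hβ').symm

lemma tendsto_norm_of_injective_of_mem_roots (he : IsStrictlyAntidominant B e) {ι : Type*}
    {f : ι → S → ℝ} (hf : f.Injective) (hroots : ∀ i, f i ∈ roots cs hB) :
    Tendsto (fun i => ‖f i‖) cofinite atTop := by
  obtain ⟨closed, discrete⟩ :=
    isClosed_and_discrete_iff.2 (disjoint_nhdsNE_roots (cs := cs) (hB := hB) he)
  have tendsto_cocompact : Tendsto f cofinite (cocompact (S → ℝ)) :=
    (closed.tendsto_coe_cofinite_of_isDiscrete discrete).comp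
      (hf.codRestrict hroots).tendsto_cofinite
  exact tendsto_norm_cocompact_atTop.comp tendsto_cocompact

end Roots

section InfiniteWord

open CoxeterSystem

variable {S W : Type*} [Group W] {M : CoxeterMatrix S} (cs : CoxeterSystem M W) (a : ℕ → S)

lemma prefixElt_zero : prefixElt cs a 0 = 1 := by
  simp [prefixElt, wordPrefix]

lemma prefixElt_succ (k : ℕ) : prefixElt cs a (k + 1) = prefixElt cs a k * cs.simple (a k) := by
  simp [prefixElt, wordPrefix, List.range_succ, cs.wordProd_append]

variable {cs a}

lemma IsInfReduced.length_inv_mul (ha : IsInfReduced cs a) {j k : ℕ} (hjk : j ≤ k) :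
    cs.length ((prefixElt cs a k)⁻¹ * prefixElt cs a j) = k - j := by
  have take : (wordPrefix a k).take j = wordPrefix a j := by
    rw [wordPrefix, ← List.map_take, List.take_range, min_eq_left hjk, wordPrefix]
  have factor : prefixElt cs a k = prefixElt cs a j * cs.wordProd ((wordPrefix a k).drop j) := by
    rw [prefixElt, prefixElt, ← take, ← cs.wordProd_append, List.take_append_drop]
  rw [factor, mul_inv_rev, inv_mul_cancel_right, cs.length_inv, ((ha k).drop j).eq]
  simp [wordPrefix]

lemma IsInfReduced.length_prefixElt (ha : IsInfReduced cs a) (k : ℕ) :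
    cs.length (prefixElt cs a k) = k := by
  simpa [prefixElt_zero] using ha.length_inv_mul k.zero_le

lemma IsInfReduced.not_isRightDescent_prefixElt (ha : IsInfReduced cs a) (k : ℕ) :
    ¬ cs.IsRightDescent (prefixElt cs a k) (a k) := by
  rw [cs.not_isRightDescent_iff, ← prefixElt_succ, ha.length_prefixElt, ha.length_prefixElt]

lemma IsInfReduced.isRightDescent_inv_mul (ha : IsInfReduced cs a) {j k : ℕ} (hjk : j < k) :
    cs.IsRightDescent ((prefixElt cs a k)⁻¹ * prefixElt cs a j) (a j) := by
  rw [cs.isRightDescent_iff, mul_assoc, ← prefixElt_succ, ha.length_inv_mul hjk,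
    ha.length_inv_mul hjk.le]
  omega

end InfiniteWord

section InversionRoots

open Filter

lemma pi_norm_le_pi_norm_of_abs_le_abs {ι : Type*} [Fintype ι] {E : ι → Type*}
    [∀ i, NormedAddCommGroup (E i)] [∀ i, Lattice (E i)] [∀ i, HasSolidNorm (E i)]
    {x y : ∀ i, E i} (h : |x| ≤ |y|) : ‖x‖ ≤ ‖y‖ :=
  (pi_norm_le_iff_of_nonneg (norm_nonneg y)).2 fun i =>
    (norm_le_norm_of_abs_le_abs (h i)).trans (norm_le_pi_norm y i)

variable {S W : Type*} [Fintype S] [DecidableEq S] [Group W] {M : CoxeterMatrix S}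
  {B : Matrix S S ℝ} (cs : CoxeterSystem M W) (hB : IsGeometric M B) (a : ℕ → S)

/-- The root `γ_k = w_k(α_{s_{k+1}})` contributed to the inversion set by the letter `s_{k+1}`. -/
noncomputable def invRoot (k : ℕ) : S → ℝ := rho cs hB (prefixElt cs a k) (simpleRoot (a k))

lemma invRoot_mem_roots (k : ℕ) : invRoot cs hB a k ∈ roots cs hB := ⟨_, _, rfl⟩

lemma rho_prefixElt (k : ℕ) (x : S → ℝ) :
    rho cs hB (prefixElt cs a k) x =
      x - ∑ j ∈ Finset.range k, (2 * form B x (simpleRoot (a j))) • invRoot cs hB a j := by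
  induction k with
  | zero => simp [prefixElt_zero]
  | succ k ih =>
    rw [prefixElt_succ, map_mul, LinearEquiv.mul_apply, rho_simple_apply, map_sub, map_smul, ih,
      Finset.sum_range_succ, sub_sub, invRoot]

variable {cs a}

lemma IsInfReduced.invRoot_nonneg (ha : IsInfReduced cs a) (k : ℕ) : 0 ≤ invRoot cs hB a k :=
  rho_simpleRoot_nonneg cs hB _ _ (ha.not_isRightDescent_prefixElt k)

lemma IsInfReduced.proj_invSet (ha : IsInfReduced cs a) :
    proj (invSet cs hB a) = Set.range fun k =>
      Projectivization.mk ℝ _ (ne_zero_of_mem_roots (invRoot_mem_roots cs hB a k)) := by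
  refine Set.Subset.antisymm ?_ ?_
  · rintro _ ⟨_, ⟨-, k, rfl⟩, -, rfl⟩
    exact ⟨k, rfl⟩
  · rintro _ ⟨k, rfl⟩
    exact ⟨_, ⟨⟨invRoot_mem_roots cs hB a k, ha.invRoot_nonneg hB k⟩, k, rfl⟩, _, rfl⟩

variable {e : S → ℝ}

lemma IsInfReduced.form_rho_invRoot_nonneg (ha : IsInfReduced cs a)
    (he : IsStrictlyAntidominant B e) {j k : ℕ} (hjk : j < k) :
    0 ≤ form B (rho cs hB (prefixElt cs a k) e) (invRoot cs hB a j) := by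
  have nonpos := rho_simpleRoot_nonpos cs hB _ _ (ha.isRightDescent_inv_mul hjk)
  have := he.form_nonpos (neg_nonneg.2 nonpos)
  rwa [map_neg, neg_nonpos, map_mul, LinearEquiv.mul_apply, ← form_rho_left] at this

variable (cs a) in
lemma IsStrictlyAntidominant.form_rho_invRoot_neg (he : IsStrictlyAntidominant B e) (k : ℕ) :
    form B (rho cs hB (prefixElt cs a k) e) (invRoot cs hB a k) < 0 := by
  rw [invRoot, form_rho]
  exact he (a k)

lemma IsInfReduced.injective_mk_invRoot (ha : IsInfReduced cs a)
    (he : IsStrictlyAntidominant B e) :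
    Function.Injective fun k =>
      Projectivization.mk ℝ _ (ne_zero_of_mem_roots (invRoot_mem_roots cs hB a k)) := by
  refine .of_lt_imp_ne fun j k hjk h => ?_
  have form_neg (k : ℕ) : form B e (invRoot cs hB a k) < 0 := he.form_neg (ha.invRoot_nonneg hB k)
    (ne_zero_of_mem_roots (invRoot_mem_roots cs hB a k))
  obtain ⟨c, hc, hjk_eq⟩ := exists_pos_smul_eq_of_mk_eq_mk h (form_neg j) (form_neg k)
  have := ha.form_rho_invRoot_nonneg hB he hjk
  rw [← hjk_eq, map_smul] at this
  exact this.not_gt (smul_neg_of_pos_of_neg hc (he.form_rho_invRoot_neg cs hB a k))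

lemma IsInfReduced.tendsto_norm_invRoot (ha : IsInfReduced cs a)
    (he : IsStrictlyAntidominant B e) : Tendsto (fun k => ‖invRoot cs hB a k‖) atTop atTop := by
  rw [← Nat.cofinite_eq_atTop]
  refine tendsto_norm_of_injective_of_mem_roots he (fun j k h => ?_) (invRoot_mem_roots cs hB a)
  exact ha.injective_mk_invRoot hB he (by simp only [h])

lemma IsInfReduced.smul_invRoot_le (ha : IsInfReduced cs a) (he : IsStrictlyAntidominant B e)
    (k : ℕ) : -(2 * form B e (simpleRoot (a k))) • invRoot cs hB a k ≤
      rho cs hB (prefixElt cs a (k + 1)) e - e := by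
  rw [rho_prefixElt, sub_sub_cancel_left, ← Finset.sum_neg_distrib]
  simp only [← neg_smul]
  exact Finset.single_le_sum (f := fun j =>
    -(2 * form B e (simpleRoot (a j))) • invRoot cs hB a j)
    (fun j _ => smul_nonneg (by linarith [he (a j)]) (ha.invRoot_nonneg hB j))
    (Finset.self_mem_range_succ k)

lemma IsInfReduced.le_rho_prefixElt (ha : IsInfReduced cs a) (he : IsStrictlyAntidominant B e)
    (k : ℕ) : e ≤ rho cs hB (prefixElt cs a k) e := by
  cases k with
  | zero => simp [prefixElt_zero]
  | succ k =>
    exact sub_nonneg.1 ((smul_nonneg (by linarith [he (a k)]) (ha.invRoot_nonneg hB k)).trans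
      (ha.smul_invRoot_le hB he k))

lemma IsInfReduced.form_rho_prefixElt_le (ha : IsInfReduced cs a) (he : IsStrictlyAntidominant B e)
    (k : ℕ) : form B e (rho cs hB (prefixElt cs a k) e) ≤ form B e e := by
  have := he.form_nonpos (sub_nonneg.2 (ha.le_rho_prefixElt hB he k))
  rwa [map_sub, sub_nonpos] at this

lemma IsInfReduced.injective_mk_rho_prefixElt (ha : IsInfReduced cs a)
    (he : IsStrictlyAntidominant B e) (hee : form B e e < 0)
    (hne : ∀ k, rho cs hB (prefixElt cs a k) e ≠ 0) :
    Function.Injective fun k => Projectivization.mk ℝ _ (hne k) := by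
  refine .of_lt_imp_ne fun j k hjk h => ?_
  have form_neg (k : ℕ) := (ha.form_rho_prefixElt_le hB he k).trans_lt hee
  obtain ⟨c, hc, hjk_eq⟩ := exists_pos_smul_eq_of_mk_eq_mk h (form_neg j) (form_neg k)
  have := he.form_rho_invRoot_neg cs hB a j
  rw [← hjk_eq, map_smul] at this
  exact this.not_ge (smul_nonneg hc.le (ha.form_rho_invRoot_nonneg hB he hjk))

lemma IsInfReduced.tendsto_norm_rho_prefixElt (ha : IsInfReduced cs a)
    (he : IsStrictlyAntidominant B e) :
    Tendsto (fun k => ‖rho cs hB (prefixElt cs a k) e‖) atTop atTop := by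
  have : Nonempty S := ⟨a 0⟩
  obtain ⟨t, ht⟩ := Finite.exists_max fun s => form B e (simpleRoot s)
  refine (tendsto_add_atTop_iff_nat 1).1 (tendsto_atTop_mono (fun k => ?_)
    (tendsto_atTop_add_const_right _ (-‖e‖)
      ((ha.tendsto_norm_invRoot hB he).const_mul_atTop (r := -(2 * form B e (simpleRoot t)))
        (by linarith [he t]))))
  have nonneg := ha.invRoot_nonneg hB k
  have le_sub : -(2 * form B e (simpleRoot t)) • invRoot cs hB a k ≤
      rho cs hB (prefixElt cs a (k + 1)) e - e :=
    (smul_le_smul_of_nonneg_right (by linarith [ht (a k)]) nonneg).trans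
      (ha.smul_invRoot_le hB he k)
  have scaled_nonneg : 0 ≤ -(2 * form B e (simpleRoot t)) • invRoot cs hB a k :=
    smul_nonneg (by linarith [he t]) nonneg
  have norm_le := pi_norm_le_pi_norm_of_abs_le_abs
    ((abs_of_nonneg scaled_nonneg).trans_le (le_sub.trans (le_abs_self _)))
  rw [norm_smul, Real.norm_of_nonneg (by linarith [he t])] at norm_le
  linarith [norm_sub_le (rho cs hB (prefixElt cs a (k + 1)) e) e]

end InversionRoots

section LimitDirection

open Filter Topology

lemma exists_abs_form_le {S : Type*} [Fintype S] [DecidableEq S] (B : Matrix S S ℝ) (R : ℝ) :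
    ∃ C, ∀ x y, ‖x‖ ≤ R → ‖y‖ ≤ R → |form B x y| ≤ C := by
  refine ⟨‖(form B).toContinuousBilinearMap‖ * R * R, fun x y hx hy => ?_⟩
  have hR : 0 ≤ R := (norm_nonneg x).trans hx
  exact ((form B).toContinuousBilinearMap.le_opNorm₂ x y).trans (by gcongr)

variable {S W : Type*} [Fintype S] [DecidableEq S] [Group W] {M : CoxeterMatrix S}
  {B : Matrix S S ℝ} {cs : CoxeterSystem M W} {hB : IsGeometric M B} {a : ℕ → S} {e u v : S → ℝ}

lemma DivergesInDirection.form_self_eq_zero_of_rho {ι : Type*} {l : Filter ι} [l.NeBot] {g : ι → W}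
    {z : ι → S → ℝ} {R : ℝ} (hz : ∀ i, ‖z i‖ ≤ R)
    (hu : DivergesInDirection (fun i => rho cs hB (g i) (z i)) l u) : form B u u = 0 := by
  obtain ⟨C, hC⟩ := exists_abs_form_le B R
  exact hu.bilin_eq_zero hu (C := C)
    (.of_forall fun i => by rw [form_rho]; exact hC _ _ (hz i) (hz i))

lemma DivergesInDirection.mk_eq_mk_of_rho (hL : IsLorentzian B) {ι : Type*} {l : Filter ι} [l.NeBot]
    {g : ι → W} {y z : ι → S → ℝ} {R : ℝ} (hy : ∀ i, ‖y i‖ ≤ R) (hz : ∀ i, ‖z i‖ ≤ R)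
    (hu : DivergesInDirection (fun i => rho cs hB (g i) (y i)) l u)
    (hv : DivergesInDirection (fun i => rho cs hB (g i) (z i)) l v) :
    Projectivization.mk ℝ u hu.ne_zero = Projectivization.mk ℝ v hv.ne_zero := by
  obtain ⟨e, -, hee⟩ := hL.exists_isStrictlyAntidominant_form_self_neg hB.isHermitian
    fun _ _ => hB.apply_nonpos
  obtain ⟨C, hC⟩ := exists_abs_form_le B R
  have orthogonal : form B u v = 0 :=
    hu.bilin_eq_zero hv (C := C) (.of_forall fun i => by rw [form_rho]; exact hC _ _ (hy i) (hz i))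
  exact mk_eq_mk_of_isotropic hB.isSymm_form (fun _ => hL.form_self_pos hB.isHermitian hee) _ _
    (hu.form_self_eq_zero_of_rho hy) (hv.form_self_eq_zero_of_rho hz) (by rw [orthogonal, mul_zero])

variable {l l' : Filter ℕ} [l.NeBot] [l'.NeBot]

lemma IsInfReduced.form_limitDirection_nonpos (ha : IsInfReduced cs a)
    (he : IsStrictlyAntidominant B e)
    (hu : DivergesInDirection (fun k => rho cs hB (prefixElt cs a k) e) l u) :
    form B e u ≤ 0 :=
  neg_nonneg.1 (hu.apply_nonneg_of_le (f := -form B e) (C := -form B e e)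
    (.of_forall fun k => neg_le_neg (ha.form_rho_prefixElt_le hB he k)))

lemma IsInfReduced.form_limitDirection_invRoot_nonneg (ha : IsInfReduced cs a)
    (he : IsStrictlyAntidominant B e) (hl : l ≤ atTop)
    (hu : DivergesInDirection (fun k => rho cs hB (prefixElt cs a k) e) l u) (j : ℕ) :
    0 ≤ form B u (invRoot cs hB a j) :=
  hu.apply_nonneg_of_le (f := (form B).flip (invRoot cs hB a j))
    (hl ((eventually_gt_atTop j).mono fun _ => ha.form_rho_invRoot_nonneg hB he))

lemma IsInfReduced.form_limitDirection_nonneg (ha : IsInfReduced cs a)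
    (he : IsStrictlyAntidominant B e) (hl : l ≤ atTop)
    (hu : DivergesInDirection (fun k => rho cs hB (prefixElt cs a k) e) l u)
    (hv : DivergesInDirection (fun k => rho cs hB (prefixElt cs a k) e) l' v) :
    0 ≤ form B u v := by
  refine hv.apply_nonneg_of_le (C := form B u e) (.of_forall fun k => ?_)
  rw [rho_prefixElt, map_sub, map_sum, le_sub_self_iff]
  refine Finset.sum_nonpos fun j _ => ?_
  rw [map_smul]
  exact mul_nonpos_of_nonpos_of_nonneg (by linarith [he (a j)])
    (ha.form_limitDirection_invRoot_nonneg he hl hu j)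

lemma IsInfReduced.mk_limitDirection_eq (hL : IsLorentzian B) (ha : IsInfReduced cs a)
    (he : IsStrictlyAntidominant B e) (hee : form B e e < 0) (hl : l ≤ atTop)
    (hu : DivergesInDirection (fun k => rho cs hB (prefixElt cs a k) e) l u)
    (hv : DivergesInDirection (fun k => rho cs hB (prefixElt cs a k) e) l' v) :
    Projectivization.mk ℝ u hu.ne_zero = Projectivization.mk ℝ v hv.ne_zero :=
  mk_eq_mk_of_isotropic hB.isSymm_form (fun _ => hL.form_self_pos hB.isHermitian hee) _ _
    (hu.form_self_eq_zero_of_rho fun _ => le_rfl) (hv.form_self_eq_zero_of_rho fun _ => le_rfl)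
    (mul_nonneg (mul_nonneg_of_nonpos_of_nonpos (ha.form_limitDirection_nonpos he hu)
      (ha.form_limitDirection_nonpos he hv)) (ha.form_limitDirection_nonneg he hl hu hv))

lemma IsInfReduced.tendsto_mk_rho_prefixElt (hL : IsLorentzian B) (ha : IsInfReduced cs a)
    (he : IsStrictlyAntidominant B e) (hee : form B e e < 0) (hl : l ≤ atTop)
    (hu : DivergesInDirection (fun k => rho cs hB (prefixElt cs a k) e) l u)
    {ι : Type*} {f : Filter ι} {ψ : ι → ℕ} (hψ : Tendsto ψ f atTop)
    {z : ι → S → ℝ} {R : ℝ} (hz : ∀ i, ‖z i‖ ≤ R)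
    (hnorm : Tendsto (fun i => ‖rho cs hB (prefixElt cs a (ψ i)) (z i)‖) f atTop)
    (hne : ∀ i, rho cs hB (prefixElt cs a (ψ i)) (z i) ≠ 0) :
    Tendsto (fun i => Projectivization.mk ℝ _ (hne i)) f
      (𝓝 (Projectivization.mk ℝ u hu.ne_zero)) := by
  refine tendsto_iff_ultrafilter _ _ _ |>.2 fun U hU => ?_
  obtain ⟨v, hv⟩ := exists_divergesInDirection (hnorm.mono_left hU)
  obtain ⟨v', hv'⟩ := exists_divergesInDirection (U := U.map ψ)
    ((ha.tendsto_norm_rho_prefixElt hB he).mono_left (hψ.mono_left hU))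
  rw [ha.mk_limitDirection_eq hL he hee hl hu hv', DivergesInDirection.mk_eq_mk_of_rho hL
    (fun _ => le_max_right R ‖e‖) (fun i => (hz i).trans (le_max_left _ _))
    (hv'.comp tendsto_map) hv]
  exact hv.tendsto_mk hne hv.ne_zero

lemma IsInfReduced.derivedSet_proj_invSet (hL : IsLorentzian B) (ha : IsInfReduced cs a)
    (he : IsStrictlyAntidominant B e) (hee : form B e e < 0) (hl : l ≤ atTop)
    (hu : DivergesInDirection (fun k => rho cs hB (prefixElt cs a k) e) l u) :
    derivedSet (proj (invSet cs hB a)) = {Projectivization.mk ℝ u hu.ne_zero} := by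
  rw [ha.proj_invSet]
  refine derivedSet_range_of_tendsto (ha.injective_mk_invRoot hB he) ?_
  rw [Nat.cofinite_eq_atTop]
  exact ha.tendsto_mk_rho_prefixElt hL he hee hl hu tendsto_id
    (z := fun k => simpleRoot (a k)) (R := 1) (fun k => (Pi.norm_single _).trans_le norm_one.le)
    (ha.tendsto_norm_invRoot hB he) _

lemma IsInfReduced.arisesFromThrough_mk (hL : IsLorentzian B) (ha : IsInfReduced cs a)
    (he : IsStrictlyAntidominant B e) (hee : form B e e < 0) (hl : l ≤ atTop)
    (hu : DivergesInDirection (fun k => rho cs hB (prefixElt cs a k) e) l u) (he0 : e ≠ 0) :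
    ArisesFromThrough (Projectivization.mk ℝ u hu.ne_zero) (Projectivization.mk ℝ e he0)
      (fun k => rho cs hB (prefixElt cs a k)) :=
  have hne (k : ℕ) : rho cs hB (prefixElt cs a k) e ≠ 0 :=
    (map_ne_zero_iff _ (LinearEquiv.injective _)).2 he0
  ⟨ha.injective_mk_rho_prefixElt hB he hee hne,
    ha.tendsto_mk_rho_prefixElt hL he hee hl hu tendsto_id (fun _ => le_rfl)
      (ha.tendsto_norm_rho_prefixElt hB he) hne⟩

lemma IsInfReduced.arisesFromThrough_of_mem_proj_roots (hL : IsLorentzian B)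
    (ha : IsInfReduced cs a) (he : IsStrictlyAntidominant B e) (hee : form B e e < 0)
    (hl : l ≤ atTop) (hu : DivergesInDirection (fun k => rho cs hB (prefixElt cs a k) e) l u)
    {p : ℙ ℝ (S → ℝ)} (hp : p ∈ proj (roots cs hB)) {φ : ℕ → ℕ} (hφ : Tendsto φ atTop atTop)
    (hinj : Function.Injective fun k => rho cs hB (prefixElt cs a (φ k)) • p) :
    ArisesFromThrough (Projectivization.mk ℝ u hu.ne_zero) p
      (fun k => rho cs hB (prefixElt cs a (φ k))) := by
  obtain ⟨β, hβ, hβ0, rfl⟩ := hp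
  refine ⟨hinj, ha.tendsto_mk_rho_prefixElt hL he hee hl hu hφ (fun _ => le_rfl) ?_
    fun k => ne_zero_of_mem_roots (rho_mem_roots _ hβ)⟩
  rw [← Nat.cofinite_eq_atTop]
  refine tendsto_norm_of_injective_of_mem_roots he (fun j k h => hinj ?_)
    fun k => rho_mem_roots _ hβ
  simp only [Projectivization.smul_mk]
  simp only [LinearEquiv.smul_def, h]

lemma IsLorentzian.exists_divergesInDirection_rho_prefixElt (hL : IsLorentzian B)
    (ha : IsInfReduced cs a) : ∃ e u, IsStrictlyAntidominant B e ∧ form B e e < 0 ∧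
      DivergesInDirection (fun k => rho cs hB (prefixElt cs a k) e) (hyperfilter ℕ) u := by
  obtain ⟨e, he, hee⟩ := hL.exists_isStrictlyAntidominant_form_self_neg hB.isHermitian
    fun _ _ => hB.apply_nonpos
  obtain ⟨u, hu⟩ := exists_divergesInDirection (U := hyperfilter ℕ)
    ((ha.tendsto_norm_rho_prefixElt hB he).mono_left Nat.hyperfilter_le_atTop)
  exact ⟨e, u, he, hee, hu⟩

end LimitDirection

end GeomCox

theorem mainTheorem4 {S W : Type*} [Fintype S] [DecidableEq S] [Group W]
    {M : CoxeterMatrix S} (cs : CoxeterSystem M W)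
    {B : Matrix S S ℝ} (hB : GeomCox.IsGeometric M B) (hL : GeomCox.IsLorentzian B)
    (a : ℕ → S) (ha : GeomCox.IsInfReduced cs a) :
    ∃ γ ∈ GeomCox.limitRoots cs hB,
      derivedSet (GeomCox.proj (GeomCox.invSet cs hB a)) = {γ} ∧
      (∃ p : ℙ ℝ (S → ℝ), GeomCox.ArisesFromThrough γ p
        (fun k => GeomCox.rho cs hB (GeomCox.prefixElt cs a k))) ∧
      (∀ p ∈ GeomCox.proj (GeomCox.roots cs hB), ∀ φ : ℕ → ℕ, StrictMono φ →
        Function.Injective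
          (fun k => GeomCox.rho cs hB (GeomCox.prefixElt cs a (φ k)) • p) →
        GeomCox.ArisesFromThrough γ p
          (fun k => GeomCox.rho cs hB (GeomCox.prefixElt cs a (φ k)))) := by
  obtain ⟨e, u, he, hee, hu⟩ := hL.exists_divergesInDirection_rho_prefixElt (hB := hB) ha
  have hl := Nat.hyperfilter_le_atTop
  have he0 : e ≠ 0 := by
    rintro rfl
    simp at hee
  have derivedSet_eq := ha.derivedSet_proj_invSet hL he hee hl hu
  have proj_subset : GeomCox.proj (GeomCox.invSet cs hB a) ⊆ GeomCox.proj (GeomCox.roots cs hB) :=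
    fun _ ⟨x, hx, h⟩ => ⟨x, hx.1.1, h⟩
  exact ⟨_, derivedSet_mono _ _ proj_subset (derivedSet_eq.ge rfl), derivedSet_eq,
    ⟨_, ha.arisesFromThrough_mk hL he hee hl hu he0⟩, fun _ hp _ hφ hinj =>
      ha.arisesFromThrough_of_mem_proj_roots hL he hee hl hu hp hφ.tendsto_atTop hinj⟩
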